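/- All rings are commutative with identity. Let $T$ be an integral domain and let $R\subset T$ be a minimal ring extension, i.e. $R$ is a proper subring of $T$ and there is no ring $S$ with $R\subsetneq S\subsetneq T$. For a prime ideal $P$ of $R$ put $T_P:=T_{R\setminus P}$. Let $J$ be the crucial maximal ideal of the extension, i.e. the (unique) maximal ideal $J$ of $R$ for which the canonical map $R_J\to T_J$ is not an isomorphism. Let $(R:T)=\{s\in T : sT\subseteq R\}$ be the conductor. Then $(R:T)=0$ if and only if one of the following holds: (a) $R$ is a field and $T$ is a minimal field extension of $R$ (i.e. $T$ is a field, $R\neq T$, and there is no field strictly between $R$ and $T$); (b) $R_J$ is a valuation ring of altitude (Krull dimension) one and $T_J$ is its quotient field. -/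

import Mathlib

namespace MinimalExt

/-- `R ⊂ T` is a minimal ring extension: `R` is a proper subring of `T`
and there is no ring strictly between `R` and `T`. -/
def IsMinimalRingExtension {T : Type*} [CommRing T] (R : Subring T) : Prop :=
  R < ⊤ ∧ ∀ S : Subring T, ¬ (R < S ∧ S < ⊤)

/-- `R ⊂ T` is a minimal field extension: `R` and `T` are fields, `R ≠ T`,
and there is no field strictly between `R` and `T`. -/
def IsMinimalFieldExtension {T : Type*} [CommRing T] (R : Subring T) : Prop :=
  IsField R ∧ IsField T ∧ R < ⊤ ∧ ∀ S : Subring T, IsField S → ¬ (R < S ∧ S < ⊤)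

/-- The conductor `(R : T) = {s ∈ T | s T ⊆ R}`, an ideal of `T`. -/
def conductor {T : Type*} [CommRing T] (R : Subring T) : Ideal T where
  carrier := {s | ∀ t : T, s * t ∈ R}
  zero_mem' := fun t => by simp [R.zero_mem]
  add_mem' := fun {a b} ha hb t => by
    rw [add_mul]; exact R.add_mem (ha t) (hb t)
  smul_mem' := fun c s hs t => by
    have h := hs (c * t)
    rwa [smul_eq_mul, mul_comm c s, mul_assoc]

/-- The localization `T_J = T_{R \ J}` of `T` at the (image in `T` of the) multiplicative
set `R \ J`. It is an algebra over `R_J` through the canonical map `R_J → T_J` that the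
inclusion `R ⊂ T` induces. -/
abbrev LocExt {T : Type*} [CommRing T] (R : Subring T) (J : Ideal R) [J.IsPrime] : Type _ :=
  Localization (Algebra.algebraMapSubmonoid T J.primeCompl)

/-- The maximal ideal `J` of `R` is crucial for `R ⊂ T`: the canonical map `R_J → T_J` is not
an isomorphism. -/
def IsCrucial {T : Type*} [CommRing T] (R : Subring T) (J : Ideal R) [J.IsMaximal] : Prop :=
  ¬ Function.Bijective (algebraMap (Localization.AtPrime J) (LocExt R J))

end MinimalExt

/-! If `R` is not a field, neither is `R_J`, and minimality and zero conductor pass to `R_J ⊂ T_J`.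
So let `A ⊂ B` be such an extension with `A` local and not a field. If `B` were integral over `A`,
it would be finite; zero conductor forces `A + aB = B` for some nonzero nonunit `a`, and Nakayama
gives `A = B`. So `A` is integrally closed in `B`. Minimality applied to `A[x²]` then puts `x` or
its inverse in `A`. Zero conductor makes nonzero elements of `A` invertible in `B`, so `A` is a
valuation ring with quotient field `B`; it has dimension one because `A[1/q] = B` for each nonzero
nonunit `q`. If `R` is a field, the same dichotomy forces `T` to be integral over `R`, hence a
field. Conversely, a nonzero conductor gives `R = T` in case (a) and makes `R_J` a field in case
(b). -/

namespace MinimalExt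

open Polynomial

/-! ### Minimal extensions of local rings -/

section Algebra

variable {A B : Type*} [CommRing A] [CommRing B] [Algebra A B]

/-- If `A` is a local ring that is integrally closed in `B`, then a root `x` in `B` of a polynomial
over `A` with some unit coefficient lies in `A` or has an inverse in `A`. -/
theorem mem_bot_or_exists_mul_eq_one_of_aeval_eq_zero [IsLocalRing A] [Nontrivial B]
    (hcl : integralClosure A B = ⊥) (x : B) (f : A[X]) (hf : aeval x f = 0) (n : ℕ)
    (hn : IsUnit (f.coeff n)) :
    x ∈ (⊥ : Subalgebra A B) ∨ ∃ y : A, algebraMap A B y * x = 1 := by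
  induction hm : f.natDegree using Nat.strong_induction_on generalizing f n with | h m ih
  obtain _ | m := m
  · obtain ⟨r, rfl⟩ := natDegree_eq_zero.mp hm
    cases n with
    | zero =>
      rw [coeff_C_zero] at hn
      rw [aeval_C] at hf
      exact absurd hf (hn.map (algebraMap A B)).ne_zero
    | succ n => simp at hn
  obtain ⟨a, ha⟩ := Algebra.mem_bot.mp (hcl.le (isIntegral_leadingCoeff_smul f x hf))
  rw [Algebra.smul_def] at ha
  by_cases hlead : IsUnit f.leadingCoeff
  · left
    obtain ⟨c, hc⟩ := hlead.exists_left_inv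
    refine Algebra.mem_bot.mpr ⟨c * a, ?_⟩
    rw [map_mul, ha, ← mul_assoc, ← map_mul, hc, map_one, one_mul]
  by_cases hua : IsUnit a
  · right
    obtain ⟨c, hc⟩ := hua.exists_left_inv
    refine ⟨c * f.leadingCoeff, ?_⟩
    rw [map_mul, mul_assoc, ← ha, ← map_mul, hc, map_one]
  -- The leading coefficient times `x` is `a`, so the top term can be traded for `a * x ^ m`. As the
  -- leading coefficient and `a` are nonunits, coefficient `n` stays a unit.
  refine ih _ ?_ (f.eraseLead + C a * X ^ m) ?_ n ?_ rfl
  · suffices f.eraseLead.natDegree ≤ m by compute_degree!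
    exact (eraseLead_natDegree_le ..).trans (by lia)
  · simp [← self_sub_monomial_natDegree_leadingCoeff, hf, hm, pow_succ', ha, mul_assoc]
  · have hne : n ≠ f.natDegree := by rintro rfl; exact hlead hn
    have hcoeff : (f.eraseLead + C a * X ^ m).coeff n = f.coeff n + if n = m then a else 0 := by
      simp [eraseLead_coeff, hne]
    rw [hcoeff]
    by_contra hnot
    refine IsLocalRing.nonunits_add (b := -if n = m then a else 0) hnot ?_ (by simpa using hn)
    split_ifs
    · simpa using hua
    · simp

/-- In a minimal extension of a local ring that is integrally closed in it, every element lies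
in the small ring or has an inverse there. -/
theorem mem_bot_or_exists_mul_eq_one [IsLocalRing A] [Nontrivial B]
    (hmin : ∀ S : Subalgebra A B, S = ⊥ ∨ S = ⊤) (hcl : integralClosure A B = ⊥) (x : B) :
    x ∈ (⊥ : Subalgebra A B) ∨ ∃ y : A, algebraMap A B y * x = 1 := by
  obtain h | h := hmin (Algebra.adjoin A {x ^ 2})
  · left
    have h2 : x ^ 2 ∈ (⊥ : Subalgebra A B) := h ▸ Algebra.self_mem_adjoin_singleton A _
    obtain ⟨a, ha⟩ := Algebra.mem_bot.mp h2
    rw [← hcl]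
    exact IsIntegral.of_pow two_pos (ha ▸ isIntegral_algebraMap)
  · have hx : x ∈ Algebra.adjoin A {x ^ 2} := h ▸ Algebra.mem_top
    rw [Algebra.adjoin_singleton_eq_range_aeval] at hx
    obtain ⟨p, hp⟩ := hx
    -- Here `x = p(x²)`; since `p(X²)` has only even powers, `p(X²) - X` has linear coefficient
    -- `-1`.
    refine mem_bot_or_exists_mul_eq_one_of_aeval_eq_zero hcl x (expand A 2 p - X) ?_ 1 ?_
    · rw [map_sub, expand_aeval, aeval_X]
      exact sub_eq_zero.mpr hp
    · rw [coeff_sub, coeff_expand two_pos]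
      simp

/-- A local ring that is not a field is integrally closed in each of its minimal extensions with
zero conductor. -/
theorem integralClosure_eq_bot_of_conductor_eq_zero [IsLocalRing A] (hA : ¬ IsField A)
    (hmin : ∀ S : Subalgebra A B, S = ⊥ ∨ S = ⊤) (hne : (⊥ : Subalgebra A B) ≠ ⊤)
    (hcond : ∀ s : A, (∀ b : B, algebraMap A B s * b ∈ (⊥ : Subalgebra A B)) → s = 0) :
    integralClosure A B = ⊥ := by
  refine (hmin _).resolve_right fun htop => hne ?_
  obtain ⟨x, hx⟩ : ∃ x : B, x ∉ (⊥ : Subalgebra A B) := by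
    by_contra! h
    exact hne (eq_top_iff.mpr fun b _ => h b)
  have hadj : Algebra.adjoin A {x} = ⊤ :=
    (hmin _).resolve_left fun h => hx (h ▸ Algebra.self_mem_adjoin_singleton A x)
  have hfg : (⊤ : Submodule A B).FG := by
    rw [← Algebra.top_toSubmodule, ← hadj]
    have hxi : x ∈ integralClosure A B := htop ▸ Algebra.mem_top
    exact IsIntegral.fg_adjoin_singleton hxi
  obtain ⟨a, ham, ha0⟩ : ∃ a ∈ IsLocalRing.maximalIdeal A, a ≠ 0 :=
    Submodule.exists_mem_ne_zero_of_ne_bot fun h =>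
      hA (IsLocalRing.isField_iff_maximalIdeal_eq.mpr h)
  -- The subring `A + aB` of `B` is all of `B`, so that Nakayama's lemma applies.
  let S : Subalgebra A B :=
    { carrier := {b | ∃ (c : A) (d : B), b = algebraMap A B c + algebraMap A B a * d}
      mul_mem' := by
        rintro _ _ ⟨c, d, rfl⟩ ⟨c', d', rfl⟩
        refine ⟨c * c', algebraMap A B c * d' + d * (algebraMap A B c' + algebraMap A B a * d'), ?_⟩
        rw [map_mul]
        ring
      add_mem' := by
        rintro _ _ ⟨c, d, rfl⟩ ⟨c', d', rfl⟩
        refine ⟨c + c', d + d', ?_⟩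
        rw [map_add]
        ring
      algebraMap_mem' := fun c => ⟨c, 0, by simp⟩ }
  have hS : S = ⊤ := by
    refine (hmin S).resolve_left fun h => ha0 (hcond a fun b => ?_)
    rw [← h]
    exact ⟨0, b, by simp⟩
  have hle : (⊤ : Submodule A B) ≤ Subalgebra.toSubmodule ⊥ := by
    refine Submodule.le_of_le_smul_of_le_jacobson_bot hfg
      (IsLocalRing.maximalIdeal_le_jacobson ⊥) fun b _ => ?_
    obtain ⟨c, d, rfl⟩ : b ∈ S := hS ▸ Algebra.mem_top
    refine Submodule.add_mem_sup (Subalgebra.algebraMap_mem ⊥ c) ?_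
    rw [← Algebra.smul_def]
    exact Submodule.smul_mem_smul ham Submodule.mem_top
  exact eq_top_iff.mpr fun b _ => hle Submodule.mem_top

/-- A minimal extension with zero conductor of a local domain that is not a field
is the extension of a valuation ring of dimension one by its quotient field. -/
theorem valuationRing_and_isFractionRing_of_conductor_eq_zero [IsDomain A] [IsLocalRing A]
    [IsDomain B] (hA : ¬ IsField A) (hinj : Function.Injective (algebraMap A B))
    (hmin : ∀ S : Subalgebra A B, S = ⊥ ∨ S = ⊤) (hne : (⊥ : Subalgebra A B) ≠ ⊤)
    (hcond : ∀ s : A, (∀ b : B, algebraMap A B s * b ∈ (⊥ : Subalgebra A B)) → s = 0) :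
    ValuationRing A ∧ ringKrullDim A = 1 ∧ IsFractionRing A B := by
  have hcl := integralClosure_eq_bot_of_conductor_eq_zero hA hmin hne hcond
  have hval := mem_bot_or_exists_mul_eq_one hmin hcl
  have hinv (a : A) (ha : a ≠ 0) : ∃ z : B, algebraMap A B a * z = 1 := by
    by_contra! h
    -- If `a` is not invertible in `B`, no `a * b` is, so all of `aB` lies in `A`.
    refine ha (hcond a fun b => (hval _).resolve_right ?_)
    rintro ⟨y, hy⟩
    exact h (algebraMap A B y * b) (by rw [← hy]; ring)
  refine ⟨?_, ?_, ?_⟩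
  · refine @ValuationRing.mk _ _ _ ⟨fun a b => ?_⟩
    obtain rfl | ha := eq_or_ne a 0
    · exact ⟨0, Or.inr (mul_zero b)⟩
    obtain ⟨z, hz⟩ := hinv a ha
    obtain h | ⟨y, hy⟩ := hval (algebraMap A B b * z)
    · obtain ⟨c, hc⟩ := Algebra.mem_bot.mp h
      refine ⟨c, Or.inl (hinj ?_)⟩
      rw [map_mul, hc]
      linear_combination algebraMap A B b * hz
    · refine ⟨y, Or.inr (hinj ?_)⟩
      rw [map_mul]
      linear_combination algebraMap A B a * hy - algebraMap A B b * algebraMap A B y * hz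
  · refine ringKrullDim_eq_one_iff_of_isLocalRing_isDomain.mpr ⟨hA, fun p hp q hq => ?_⟩
    obtain rfl | hq0 := eq_or_ne q 0
    · exact Ideal.zero_mem _
    obtain ⟨z, hz⟩ := hinv q hq0
    obtain ⟨w, hw⟩ := hinv p hp
    -- The localization of `A` at the powers of `q`, as a subring of `B`.
    let S : Subalgebra A B :=
      { carrier := {b | ∃ (n : ℕ) (c : A), algebraMap A B (q ^ n) * b = algebraMap A B c}
        mul_mem' := by
          rintro b b' ⟨n, c, h⟩ ⟨n', c', h'⟩
          refine ⟨n + n', c * c', ?_⟩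
          rw [pow_add, map_mul, map_mul, ← h, ← h']
          ring
        add_mem' := by
          rintro b b' ⟨n, c, h⟩ ⟨n', c', h'⟩
          refine ⟨n + n', q ^ n' * c + q ^ n * c', ?_⟩
          rw [pow_add, map_mul, map_add, map_mul, map_mul, ← h, ← h']
          ring
        algebraMap_mem' := fun c => ⟨0, c, by simp⟩ }
    have hS : S = ⊤ := by
      refine (hmin S).resolve_left fun h => ?_
      have hzS : z ∈ S := ⟨1, 1, by rw [pow_one, hz, map_one]⟩
      rw [h] at hzS
      obtain ⟨c, rfl⟩ := Algebra.mem_bot.mp hzS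
      refine (IsLocalRing.mem_maximalIdeal q).mp hq (.of_mul_eq_one c (hinj ?_))
      rw [map_mul, hz, map_one]
    obtain ⟨n, c, hc⟩ : w ∈ S := hS ▸ Algebra.mem_top
    refine ⟨n, Ideal.mem_span_singleton'.mpr ⟨c, hinj ?_⟩⟩
    rw [map_mul, ← hc]
    linear_combination algebraMap A B (q ^ n) * hw
  · have hunit : ∀ a : nonZeroDivisors A, IsUnit (algebraMap A B a) := fun a => by
      obtain ⟨z, hz⟩ := hinv a (nonZeroDivisors.ne_zero a.2)
      exact .of_mul_eq_one z hz
    refine ⟨hunit, fun b => ?_, fun {a a'} h => ⟨1, by rw [hinj h]⟩⟩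
    obtain h | ⟨y, hy⟩ := hval b
    · obtain ⟨c, rfl⟩ := Algebra.mem_bot.mp h
      exact ⟨(c, 1), by simp⟩
    · have hy0 : y ≠ 0 := by
        rintro rfl
        simp at hy
      exact ⟨(1, ⟨y, mem_nonZeroDivisors_of_ne_zero hy0⟩), by simpa [mul_comm] using hy⟩

end Algebra

/-! ### Minimal subrings and localization at the crucial ideal -/

section Subring

variable {T : Type*} [CommRing T] {R : Subring T}

theorem IsMinimalRingExtension.eq_or_eq_top (hRT : IsMinimalRingExtension R) {S : Subring T}
    (hS : R ≤ S) : S = R ∨ S = ⊤ := by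
  by_contra! h
  exact hRT.2 S ⟨hS.lt_of_ne h.1.symm, h.2.lt_top⟩

theorem IsMinimalRingExtension.subalgebra_eq_bot_or_eq_top (hRT : IsMinimalRingExtension R)
    (S : Subalgebra R T) : S = ⊥ ∨ S = ⊤ := by
  have hS : R ≤ S.toSubring := fun r hr => S.algebraMap_mem ⟨r, hr⟩
  refine (hRT.eq_or_eq_top hS).imp (fun h => eq_bot_iff.mpr fun t ht => ?_)
    fun h => eq_top_iff.mpr fun t _ => ?_
  · have htR : t ∈ R := h ▸ (show t ∈ S.toSubring from ht)
    exact Algebra.mem_bot.mpr ⟨⟨t, htR⟩, rfl⟩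
  · exact (h ▸ Subring.mem_top t : t ∈ S.toSubring)

theorem IsMinimalRingExtension.isMinimalFieldExtension [IsDomain T]
    (hRT : IsMinimalRingExtension R) (hR : IsField R) : IsMinimalFieldExtension R := by
  refine ⟨hR, ?_, hRT.1, fun S _ => hRT.2 S⟩
  have hmin := hRT.subalgebra_eq_bot_or_eq_top
  have : IsLocalRing R := letI := hR.toField; inferInstance
  have htop : integralClosure R T = ⊤ := by
    refine (hmin _).resolve_left fun hcl => hRT.1.not_ge fun t _ => ?_
    have hbot : t ∈ (⊥ : Subalgebra R T) := by
      refine (mem_bot_or_exists_mul_eq_one hmin hcl t).elim id ?_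
      rintro ⟨y, hy⟩
      have hy0 : y ≠ 0 := by
        rintro rfl
        simp at hy
      obtain ⟨z, hz⟩ := hR.mul_inv_cancel hy0
      refine Algebra.mem_bot.mpr ⟨z, ?_⟩
      have hz' : algebraMap R T y * algebraMap R T z = 1 := by rw [← map_mul, hz, map_one]
      linear_combination t * hz' - algebraMap R T z * hy
    obtain ⟨r, rfl⟩ := Algebra.mem_bot.mp hbot
    exact r.2
  have : Algebra.IsIntegral R T := integralClosure_eq_top_iff.mp htop
  exact isField_of_isIntegral_of_isField' hR

variable {J : Ideal R} [J.IsMaximal]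

theorem LocExt.isDomain [IsDomain T] : IsDomain (LocExt R J) := by
  refine IsLocalization.isDomain_localization ?_
  rintro _ ⟨s, hs, rfl⟩
  refine mem_nonZeroDivisors_of_ne_zero fun h => hs ?_
  have hs0 : s = 0 := Subtype.ext h
  exact hs0 ▸ J.zero_mem

/-- Every element of `T_J` is `t / s` with `t ∈ T` and `s ∈ R` invertible in `R_J`. -/
theorem LocExt.exists_numerator (x : LocExt R J) :
    ∃ (t : T) (s : R) (c : Localization.AtPrime J),
      x * algebraMap T (LocExt R J) s = algebraMap T (LocExt R J) t ∧
        x = algebraMap T (LocExt R J) t * algebraMap _ (LocExt R J) c := by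
  obtain ⟨⟨t, _, s, hs, rfl⟩, h⟩ :=
    IsLocalization.surj (Algebra.algebraMapSubmonoid T J.primeCompl) x
  obtain ⟨c, hc⟩ :=
    (IsLocalization.map_units (Localization.AtPrime J) (⟨s, hs⟩ : J.primeCompl)).exists_right_inv
  have hc' : algebraMap T (LocExt R J) s *
      algebraMap (Localization.AtPrime J) (LocExt R J) c = 1 := by
    rw [← map_one (algebraMap (Localization.AtPrime J) (LocExt R J)), ← hc, map_mul,
      ← IsScalarTower.algebraMap_apply R (Localization.AtPrime J) (LocExt R J),
      IsScalarTower.algebraMap_apply R T (LocExt R J)]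
    rfl
  refine ⟨t, s, c, h, ?_⟩
  rw [← h, mul_assoc]
  exact (mul_one x).symm.trans (congrArg (x * ·) hc'.symm)

theorem algebraMap_mem_of_mem (S : Subalgebra (Localization.AtPrime J) (LocExt R J)) {t : T}
    (ht : t ∈ R) : algebraMap T (LocExt R J) t ∈ S := by
  have h : algebraMap T (LocExt R J) t =
      algebraMap (Localization.AtPrime J) (LocExt R J) (algebraMap R _ ⟨t, ht⟩) := by
    rw [← IsScalarTower.algebraMap_apply R (Localization.AtPrime J) (LocExt R J),
      IsScalarTower.algebraMap_apply R T (LocExt R J)]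
    rfl
  rw [h]
  exact S.algebraMap_mem _

/-- An `R_J`-subalgebra of `T_J` is everything or meets `T` in `R`. -/
theorem IsMinimalRingExtension.locExt_eq_top_or_mem (hRT : IsMinimalRingExtension R)
    (S : Subalgebra (Localization.AtPrime J) (LocExt R J)) :
    S = ⊤ ∨ ∀ t : T, algebraMap T (LocExt R J) t ∈ S → t ∈ R := by
  have hle : R ≤ S.toSubring.comap (algebraMap T (LocExt R J)) :=
    fun t ht => algebraMap_mem_of_mem S ht
  obtain h | h := hRT.eq_or_eq_top hle
  · exact Or.inr fun t ht => h ▸ (show t ∈ S.toSubring.comap (algebraMap T (LocExt R J)) from ht)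
  · refine Or.inl (eq_top_iff.mpr fun x _ => ?_)
    obtain ⟨t, s, c, -, rfl⟩ := LocExt.exists_numerator x
    exact S.mul_mem (h ▸ Subring.mem_top t : t ∈ S.toSubring.comap (algebraMap T (LocExt R J)))
      (S.algebraMap_mem c)

/-- If `S` meets `T` in `R`, any `t / s` in `S` has `t = s * (t / s)` in `R`, hence lies in `R_J`.
-/
theorem IsMinimalRingExtension.locExt_eq_bot_or_eq_top (hRT : IsMinimalRingExtension R)
    (S : Subalgebra (Localization.AtPrime J) (LocExt R J)) : S = ⊥ ∨ S = ⊤ := by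
  refine (hRT.locExt_eq_top_or_mem S).symm.imp_left fun h => eq_bot_iff.mpr fun x hx => ?_
  obtain ⟨t, s, c, hts, hxt⟩ := LocExt.exists_numerator x
  rw [hxt]
  refine Subalgebra.mul_mem ⊥ (algebraMap_mem_of_mem ⊥ (h t ?_)) (Subalgebra.algebraMap_mem ⊥ c)
  rw [← hts]
  exact S.mul_mem hx (algebraMap_mem_of_mem S s.2)

theorem locExt_algebraMap_injective :
    Function.Injective (algebraMap (Localization.AtPrime J) (LocExt R J)) :=
  localizationAlgebra_injective (M := J.primeCompl) (S := T) _ _ Subtype.val_injective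

theorem IsCrucial.locExt_bot_ne_top (hJ : IsCrucial R J) :
    (⊥ : Subalgebra (Localization.AtPrime J) (LocExt R J)) ≠ ⊤ := fun h =>
  hJ ⟨locExt_algebraMap_injective, fun _ =>
    Algebra.mem_bot.mp (h ▸ Algebra.mem_top)⟩

/-- As `J` is crucial, `R_J` meets `T` in `R`, so a numerator of `s` lies in the conductor of `R` in
`T`. -/
theorem IsMinimalRingExtension.locExt_conductor_eq_zero (hRT : IsMinimalRingExtension R)
    (hJ : IsCrucial R J) (hcond : conductor R = ⊥) (s : Localization.AtPrime J)
    (hs : ∀ b : LocExt R J, algebraMap _ (LocExt R J) s * b ∈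
      (⊥ : Subalgebra (Localization.AtPrime J) (LocExt R J))) : s = 0 := by
  have hmem := (hRT.locExt_eq_top_or_mem (J := J) ⊥).resolve_left hJ.locExt_bot_ne_top
  obtain ⟨⟨r, u⟩, hru⟩ := IsLocalization.surj J.primeCompl s
  have hr : (r : T) ∈ conductor R := fun t => hmem _ <| by
    have h : algebraMap T (LocExt R J) (r * t) = algebraMap _ (LocExt R J) s *
        (algebraMap _ (LocExt R J) (algebraMap R (Localization.AtPrime J) u) *
          algebraMap T (LocExt R J) t) := by
      rw [← mul_assoc, ← map_mul, hru, map_mul,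
        ← IsScalarTower.algebraMap_apply R (Localization.AtPrime J) (LocExt R J),
        IsScalarTower.algebraMap_apply R T (LocExt R J)]
      rfl
    rw [h]
    exact hs _
  rw [hcond] at hr
  have hr0 : r = 0 := Subtype.ext hr
  rw [hr0, map_zero] at hru
  exact ((IsLocalization.map_units _ u).mul_left_eq_zero).mp hru

theorem conductor_eq_bot_of_isField (hR : R < ⊤) (hT : IsField T) : conductor R = ⊥ := by
  refine eq_bot_iff.mpr fun s hs => by_contra fun hs0 => hR.not_ge fun t _ => ?_
  obtain ⟨z, hz⟩ := hT.mul_inv_cancel hs0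
  have h : s * (z * t) ∈ R := hs (z * t)
  rwa [← mul_assoc, hz, one_mul] at h

theorem conductor_eq_bot_of_isFractionRing [IsDomain T]
    (hdim : ringKrullDim (Localization.AtPrime J) = 1)
    (hfrac : IsFractionRing (Localization.AtPrime J) (LocExt R J)) : conductor R = ⊥ := by
  refine eq_bot_iff.mpr fun s hs => by_contra fun hs0 => ?_
  have hsR : s ∈ R := by simpa using hs 1
  have hunit (a : Localization.AtPrime J) (ha : a ≠ 0) :
      ∃ z : LocExt R J, algebraMap _ (LocExt R J) a * z = 1 :=
    (IsLocalization.map_units (LocExt R J)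
      (⟨a, mem_nonZeroDivisors_of_ne_zero ha⟩ : nonZeroDivisors _)).exists_right_inv
  have hloc0 : algebraMap R (Localization.AtPrime J) ⟨s, hsR⟩ ≠ 0 := fun h =>
    hs0 <| congrArg Subtype.val <| IsLocalization.injective (Localization.AtPrime J)
      J.primeCompl_le_nonZeroDivisors (h.trans (map_zero _).symm)
  obtain ⟨w, hw⟩ := hunit _ hloc0
  have hw' : algebraMap T (LocExt R J) s * w = 1 := by
    rw [← hw, ← IsScalarTower.algebraMap_apply R (Localization.AtPrime J) (LocExt R J),
      IsScalarTower.algebraMap_apply R T (LocExt R J)]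
    rfl
  -- Since `s` is invertible in `T_J` and `sT ⊆ R`, all of `T_J = s T_J` lies in `R_J`; in
  -- particular inverses `z` do.
  have hfield : IsField (Localization.AtPrime J) := by
    refine ⟨exists_pair_ne _, mul_comm, fun {a} ha => ?_⟩
    obtain ⟨z, hz⟩ := hunit a ha
    obtain ⟨t, -, c, -, htc⟩ := LocExt.exists_numerator (w * z)
    have hzs : z = algebraMap T (LocExt R J) (s * t) * algebraMap _ (LocExt R J) c := by
      rw [map_mul]
      linear_combination algebraMap T (LocExt R J) s * htc - z * hw'
    have hzmem : z ∈ (⊥ : Subalgebra (Localization.AtPrime J) (LocExt R J)) := by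
      rw [hzs]
      exact Subalgebra.mul_mem ⊥ (algebraMap_mem_of_mem ⊥ (hs t)) (Subalgebra.algebraMap_mem ⊥ c)
    obtain ⟨b, rfl⟩ := Algebra.mem_bot.mp hzmem
    exact ⟨b, locExt_algebraMap_injective (by rw [map_mul, hz, map_one])⟩
  exact zero_ne_one ((ringKrullDim_eq_zero_of_isField hfield).symm.trans hdim)

end Subring

end MinimalExt

theorem theorem3p4 {T : Type*} [CommRing T] [IsDomain T] (R : Subring T)
    (hRT : MinimalExt.IsMinimalRingExtension R)
    (J : Ideal R) [J.IsMaximal] (hJ : MinimalExt.IsCrucial R J) :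
    MinimalExt.conductor R = ⊥ ↔
      (MinimalExt.IsMinimalFieldExtension R ∨
        (ValuationRing (Localization.AtPrime J) ∧
          ringKrullDim (Localization.AtPrime J) = 1 ∧
          IsFractionRing (Localization.AtPrime J) (MinimalExt.LocExt R J))) := by
  constructor
  · intro hcond
    by_cases hR : IsField R
    · exact Or.inl (hRT.isMinimalFieldExtension hR)
    right
    have : IsDomain (MinimalExt.LocExt R J) := MinimalExt.LocExt.isDomain
    refine MinimalExt.valuationRing_and_isFractionRing_of_conductor_eq_zero (fun hloc => hR ?_)
      MinimalExt.locExt_algebraMap_injective hRT.locExt_eq_bot_or_eq_top hJ.locExt_bot_ne_top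
      (hRT.locExt_conductor_eq_zero hJ hcond)
    -- The zero maximal ideal of the field `R_J` contracts to `J`, so `0` is maximal in `R`.
    have hbot : J = ⊥ := by
      rw [← IsLocalization.AtPrime.under_maximalIdeal (Localization.AtPrime J) J,
        IsLocalRing.isField_iff_maximalIdeal_eq.mp hloc]
      exact Ideal.comap_bot_of_injective _
        (IsLocalization.injective _ J.primeCompl_le_nonZeroDivisors)
    exact Ring.isField_iff_maximal_bot.mpr (hbot ▸ inferInstance)
  · rintro (⟨-, hT, hlt, -⟩ | ⟨-, hdim, hfrac⟩)
    · exact MinimalExt.conductor_eq_bot_of_isField hlt hT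
    · exact MinimalExt.conductor_eq_bot_of_isFractionRing hdim hfrac
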